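/- Signatures are relational, i.e. sets of relation symbols with assigned (finite) arities. A *logic* $\mathcal L$ assigns to every signature $\Sigma$ and $n\in\mathbb N$ a set of $\mathcal L[\Sigma]$-formulas $\phi(x_1,\ldots,x_n)$ together with a satisfaction relation $G\models\phi(a_1,\ldots,a_n)$, for $\Sigma$-structures $G$ and $a_1,\dots,a_n\in V(G)$, that is invariant under isomorphism; moreover, up to logical equivalence and injective renaming of symbols, every $\mathcal L[\Sigma]$-formula is also an $\mathcal L[\Sigma']$-formula whenever $\Sigma\subseteq\Sigma'$. The logic $\mathcal L$ *extends FO* if for every signature $\Sigma$, every relation symbol $R(\bar x)\notin\Sigma$, every first-order formula $\phi(\bar y)$ over $\Sigma\cup\{R\}$ and every $\mathcal L[\Sigma]$-formula $\rho(\bar x)$, the formula obtained from $\phi$ by replacing each occurrence of $R$ with $\rho$ is (equivalent to) an $\mathcal L[\Sigma]$-formula. For $k\in\mathbb N$ let $\Sigma^{(k)}$ be the expansion of $\Sigma$ by $k$ new unary predicates. For a class $\mathcal C$ of $\Sigma$-structures (finite or infinite), let $\mathcal C^{(k)}$ be the class of all $\Sigma^{(k)}$-structures that become a member of $\mathcal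 C$ when the new predicates are forgotten. An $\mathcal L[\Sigma]$-formula $\phi(\bar x,\bar y)$ with $|\bar x|=|\bar y|$ has the *order-property* on $\mathcal C$ if for every $\ell\in\mathbb N$ there are $G\in\mathcal C$ and tuples $\bar a_1,\ldots,\bar a_\ell\in V(G)^{|\bar x|}$ such that for all $i,j\in\{1,\dots,\ell\}$: $G\models\phi(\bar a_i,\bar a_j)$ if and only if $i\le j$. The class $\mathcal C$ is *$\mathcal L$-stable* if no $\mathcal L[\Sigma]$-formula has the order-property on $\mathcal C$, and *monadically $\mathcal L$-stable* if $\mathcal C^{(k)}$ is $\mathcal L$-stable for every $k\in\mathbb N$. The class $\mathcal C$ *$\mathcal L$-transduces* a class $\mathcal D$ of $\Sigma_2$-structures if there are $k\in\mathbb N$, an $\mathcal L[\Sigma^{(k)}]$-formula $\delta(x)$ and, for every $R\in\Sigma_2$ of arity $m$, an $\mathcal L[\Sigma^{(k)}]$-formula $\phi_R(x_1,\ldots,x_m)$, such that every member of $\mathcal D$ is isomorphic, for some $G^+\in\mathcal C^{(k)}$, to the $\Sigma_2$-structure with universe $U=\{a\in V(G^+): G^+\models\delta(a)\}$ in which every $R\in\Sigma_2$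 of arity $m$ is interpreted as $\{\bar a\in U^m: G^+\models\phi_R(\bar a)\}$. The *half-graph of order $t$* is the graph on vertices $a_1,\ldots,a_t,b_1,\ldots,b_t$ whose edges are exactly the pairs $a_ib_j$ with $i\le j$. Graphs are structures over the signature with one binary relation symbol. **Lemma.** First-order logic (FO), monadic second-order logic (MSO) and counting monadic second-order logic (CMSO, i.e. MSO with the constraints "$|X|\equiv r \pmod k$", $0\le r<k$, for set variables $X$, which hold only for finite $X$) extend FO. For every logic $\mathcal L$ that extends FO, every signature $\Sigma$ and every class $\mathcal C$ of $\Sigma$-structures, $\mathcal C$ is monadically $\mathcal L$-stable if and only if $\mathcal C$ does not $\mathcal L$-transduce the class of all half-graphs. -/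

import Mathlib

open CategoryTheory FirstOrder

universe u v w

/-! ## Signatures, structures, colorings

A relational signature is a `FirstOrder.Language` without function symbols; a class of structures
is a set of bundled structures (finite or infinite, not necessarily closed under isomorphism). -/

/-- The forgetful operation along a map of signatures, on bundled structures. -/
abbrev bundledReduct {Λ Λ' : FirstOrder.Language.{0, u}} (ι : Λ →ᴸ Λ') (M : Bundled.{v} Λ'.Structure) :
    Bundled.{v} Λ.Structure :=
  ⟨M, ι.reduct M⟩

/-- The relation symbols `C_1, …, C_k`, all of them unary. -/
inductive ColorRel (k : ℕ) : ℕ → Type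
  | color (i : Fin k) : ColorRel k 1

/-- The signature consisting of `k` unary predicates. -/
def colorLanguage (k : ℕ) : FirstOrder.Language.{0, 0} := ⟨fun _ => Empty, ColorRel k⟩

instance (k : ℕ) : (colorLanguage k).IsRelational := fun _ => inferInstanceAs (IsEmpty Empty)

/-- The expansion `Λ^(k)` of the signature `Λ` by `k` new unary predicates. -/
abbrev colored (Λ : FirstOrder.Language.{0, u}) (k : ℕ) : FirstOrder.Language.{0, u} := Λ.sum (colorLanguage k)

/-- The class `C^(k)` of all `k`-colorings of structures from `C`: the `Λ^(k)`-structures which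
become a member of `C` when the color predicates are forgotten. -/
def colorings {Λ : FirstOrder.Language.{0, u}} (C : Set (Bundled.{v} Λ.Structure)) (k : ℕ) :
    Set (Bundled.{v} (colored Λ k).Structure) :=
  {G | bundledReduct (FirstOrder.Language.LHom.sumInl : Λ →ᴸ colored Λ k) G ∈ C}

/-- A single relation symbol, of arity `r`. -/
inductive OneRel (r : ℕ) : ℕ → Type
  | symb : OneRel r r

/-- The signature `{R}` with one `r`-ary relation symbol `R`. -/
def oneRelLanguage (r : ℕ) : FirstOrder.Language.{0, 0} := ⟨fun _ => Empty, OneRel r⟩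

instance (r : ℕ) : (oneRelLanguage r).IsRelational := fun _ => inferInstanceAs (IsEmpty Empty)

/-- The `{R}`-structure on `M` in which `R` is interpreted as `P`. -/
abbrev oneRelStructure {r : ℕ} {M : Type v} (P : (Fin r → M) → Prop) :
    (oneRelLanguage r).Structure M where
  funMap := fun f => f.elim
  RelMap := fun {_} R => match R with
    | .symb => P

/-- The expansion of a `Λ`-structure to a `Λ ∪ {R}`-structure that interprets `R` as `P`. -/
abbrev expandByRel {Λ : FirstOrder.Language.{0, u}} (M : Bundled.{v} Λ.Structure) {r : ℕ}
    (P : (Fin r → M) → Prop) : Bundled.{v} (Λ.sum (oneRelLanguage r)).Structure :=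
  ⟨M, @FirstOrder.Language.sumStructure Λ (oneRelLanguage r) M M.str (oneRelStructure P)⟩

/-! ## Logics -/

/-- A logic over relational signatures. `Form Λ n` is the set of formulas over `Λ` with free
(first-order) variables among `x_0, …, x_{n-1}`, and `Sat φ M a` says `M ⊨ φ(a)`.
The two laws are the usual ones: satisfaction is invariant under isomorphism, and up to logical
equivalence every formula over a signature is also a formula over each larger signature
(where a signature may be included in another one by renaming its symbols injectively). -/
structure AbstractLogic where
  Form : (Λ : FirstOrder.Language.{0, u}) → [Λ.IsRelational] → ℕ → Type w
  Sat : {Λ : FirstOrder.Language.{0, u}} → [Λ.IsRelational] → {n : ℕ} → Form Λ n →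
    (M : Bundled.{v} Λ.Structure) → (Fin n → M) → Prop
  sat_iso : ∀ {Λ : FirstOrder.Language.{0, u}} [Λ.IsRelational] {n : ℕ} (φ : Form Λ n)
    (M N : Bundled.{v} Λ.Structure) (e : M ≃[Λ] N) (a : Fin n → M),
    Sat φ M a ↔ Sat φ N (fun i => e (a i))
  exists_expansion : ∀ {Λ Λ' : FirstOrder.Language.{0, u}} [Λ.IsRelational] [Λ'.IsRelational]
    (ι : Λ →ᴸ Λ'), ι.Injective → ∀ {n : ℕ} (φ : Form Λ n), ∃ φ' : Form Λ' n,
      ∀ (M : Bundled.{v} Λ'.Structure) (a : Fin n → M),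
        Sat φ' M a ↔ Sat φ (bundledReduct ι M) a

/-- A logic *extends FO* if for every relation symbol `R`, every first-order formula `φ` over
`Λ ∪ {R}` and every formula `ρ` of the logic over `Λ`, the result of replacing `R` by `ρ` in `φ`
is (equivalent to) a formula of the logic over `Λ`. -/
def AbstractLogic.ExtendsFO (L : AbstractLogic.{u, v, w}) : Prop :=
  ∀ (Λ : FirstOrder.Language.{0, u}) [Λ.IsRelational] (r : ℕ) (ρ : L.Form Λ r) (n : ℕ)
    (φ : (Λ.sum (oneRelLanguage r)).Formula (Fin n)),
    ∃ φ' : L.Form Λ n, ∀ (M : Bundled.{v} Λ.Structure) (a : Fin n → M),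
      L.Sat φ' M a ↔
        FirstOrder.Language.Formula.Realize (M := expandByRel M (L.Sat ρ M)) φ a

/-- First-order logic. -/
def FO : AbstractLogic.{u, v, u} where
  Form := fun Λ _ n => Λ.Formula (Fin n)
  Sat := fun φ _ a => φ.Realize a
  sat_iso := fun φ _ _ e a =>
    (FirstOrder.Language.StrongHomClass.realize_formula e φ (v := a)).symm
  exists_expansion := fun {Λ _} _ _ ι _ {_} φ => ⟨ι.onFormula φ, fun M _ =>
    letI : Λ.Structure M := ι.reduct M
    FirstOrder.Language.LHom.realize_onFormula ι φ⟩

/-- Formulas of monadic second-order logic over a relational signature, with free first-order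
variables `x_0, …, x_{n-1}` and free set variables `X_0, …, X_{m-1}`. The cardinality constraints
`card_{r,k}(X)` of counting monadic second-order logic are available only if `counting` holds. -/
inductive MonadicFormula (counting : Prop) (Λ : FirstOrder.Language.{0, u}) : ℕ → ℕ → Type u
  | falsum {n m : ℕ} : MonadicFormula counting Λ n m
  | equal {n m : ℕ} (i j : Fin n) : MonadicFormula counting Λ n m
  | rel {n m k : ℕ} (R : Λ.Relations k) (x : Fin k → Fin n) : MonadicFormula counting Λ n m
  | mem {n m : ℕ} (i : Fin n) (X : Fin m) : MonadicFormula counting Λ n m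
  | card {n m : ℕ} (hc : counting) (r k : ℕ) (hrk : r < k) (X : Fin m) :
      MonadicFormula counting Λ n m
  | imp {n m : ℕ} (φ ψ : MonadicFormula counting Λ n m) : MonadicFormula counting Λ n m
  | all {n m : ℕ} (φ : MonadicFormula counting Λ (n + 1) m) : MonadicFormula counting Λ n m
  | allSet {n m : ℕ} (φ : MonadicFormula counting Λ n (m + 1)) : MonadicFormula counting Λ n m

/-- Satisfaction of monadic formulas. Quantifiers bind the last variable. The constraint
`card_{r,k}(X)` holds if and only if `X` is a finite set with `|X| ≡ r (mod k)`. -/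
def MonadicFormula.Realize {counting : Prop} {Λ : FirstOrder.Language.{0, u}} {M : Type v} [Λ.Structure M] :
    {n m : ℕ} → MonadicFormula counting Λ n m → (Fin n → M) → (Fin m → Set M) → Prop
  | _, _, .falsum, _, _ => False
  | _, _, .equal i j, a, _ => a i = a j
  | _, _, .rel R x, a, _ => FirstOrder.Language.Structure.RelMap R (fun i => a (x i))
  | _, _, .mem i X, a, A => a i ∈ A X
  | _, _, .card _ r k _ X, _, A => (A X).Finite ∧ (A X).ncard ≡ r [MOD k]
  | _, _, .imp φ ψ, a, A => φ.Realize a A → ψ.Realize a A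
  | _, _, .all φ, a, A => ∀ b : M, φ.Realize (Fin.snoc a b) A
  | _, _, .allSet φ, a, A => ∀ B : Set M, φ.Realize a (Fin.snoc A B)

theorem MonadicFormula.realize_iso {counting : Prop} {Λ : FirstOrder.Language.{0, u}} {M N : Type v}
    [Λ.Structure M] [Λ.Structure N] (e : M ≃[Λ] N) {n m : ℕ}
    (φ : MonadicFormula counting Λ n m) (a : Fin n → M) (A : Fin m → Set M) :
    φ.Realize a A ↔ φ.Realize (fun i => e (a i)) (fun i => e '' A i) := by
  induction φ with
  | falsum => rfl
  | equal i j => exact e.injective.eq_iff.symm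
  | rel R x => exact (e.map_rel R _).symm
  | mem i X => exact (e.injective.mem_set_image).symm
  | card hc r k hrk X =>
    simp only [MonadicFormula.Realize]
    rw [Set.ncard_image_of_injective _ e.injective,
      Set.finite_image_iff e.injective.injOn]
  | imp φ ψ ih₁ ih₂ => simp only [MonadicFormula.Realize, ih₁, ih₂]
  | all φ ih =>
    simp only [MonadicFormula.Realize, ih]
    have key : ∀ b, (fun i => e ((Fin.snoc a b : Fin _ → M) i))
        = (Fin.snoc (fun i => e (a i)) (e b) : Fin _ → N) := by
      intro b
      funext i
      refine Fin.lastCases ?_ (fun j => ?_) i <;> simp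
    simp only [key]
    exact e.toEquiv.forall_congr (fun {_} => Iff.rfl)
  | allSet φ ih =>
    simp only [MonadicFormula.Realize, ih]
    have key : ∀ B : Set M, (fun i => e '' ((Fin.snoc A B : Fin _ → Set M) i))
        = (Fin.snoc (fun i => e '' (A i)) (e '' B) : Fin _ → Set N) := by
      intro B
      funext i
      refine Fin.lastCases ?_ (fun j => ?_) i <;> simp
    simp only [key]
    exact ((Equiv.Set.congr e.toEquiv).forall_congr (fun {_} => Iff.rfl))

/-- Renaming the relation symbols of a monadic formula. -/
def MonadicFormula.mapRel {counting : Prop} {Λ Λ' : FirstOrder.Language.{0, u}} (ι : Λ →ᴸ Λ') :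
    {n m : ℕ} → MonadicFormula counting Λ n m → MonadicFormula counting Λ' n m
  | _, _, .falsum => .falsum
  | _, _, .equal i j => .equal i j
  | _, _, .rel R x => .rel (ι.onRelation R) x
  | _, _, .mem i X => .mem i X
  | _, _, .card hc r k hrk X => .card hc r k hrk X
  | _, _, .imp φ ψ => .imp (φ.mapRel ι) (ψ.mapRel ι)
  | _, _, .all φ => .all (φ.mapRel ι)
  | _, _, .allSet φ => .allSet (φ.mapRel ι)

theorem MonadicFormula.realize_mapRel {counting : Prop} {Λ Λ' : FirstOrder.Language.{0, u}}
    (ι : Λ →ᴸ Λ') {M : Type v} [Λ'.Structure M] {n m : ℕ}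
    (φ : MonadicFormula counting Λ n m) (a : Fin n → M) (A : Fin m → Set M) :
    (φ.mapRel ι).Realize a A ↔
      @MonadicFormula.Realize counting Λ M (ι.reduct M) n m φ a A := by
  induction φ with
  | falsum => rfl
  | equal i j => rfl
  | rel R x => rfl
  | mem i X => rfl
  | card hc r k hrk X => rfl
  | imp φ ψ ih₁ ih₂ => simp only [MonadicFormula.Realize, MonadicFormula.mapRel, ih₁, ih₂]
  | all φ ih => simp only [MonadicFormula.Realize, MonadicFormula.mapRel, ih]
  | allSet φ ih => simp only [MonadicFormula.Realize, MonadicFormula.mapRel, ih]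

/-- Monadic second-order logic, with or without cardinality constraints. The formulas of the logic
have only first-order free variables. -/
def monadicLogic (counting : Prop) : AbstractLogic.{u, v, u} where
  Form := fun Λ _ n => MonadicFormula counting Λ n 0
  Sat := fun φ _ a => φ.Realize a Fin.elim0
  sat_iso := fun φ _ _ e a => by
    rw [φ.realize_iso e a Fin.elim0]
    exact iff_of_eq (congrArg _ (Subsingleton.elim _ _))
  exists_expansion := fun {_ _} _ _ ι _ {_} φ => ⟨φ.mapRel ι, fun _ a => φ.realize_mapRel ι a _⟩

/-- Monadic second-order logic. -/
abbrev MSO : AbstractLogic.{u, v, u} := monadicLogic False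

/-- Counting monadic second-order logic. -/
abbrev CMSO : AbstractLogic.{u, v, u} := monadicLogic True

/-! ## Stability -/

namespace AbstractLogic

variable (L : AbstractLogic.{u, v, w}) {Λ : FirstOrder.Language.{0, u}} [Λ.IsRelational]

/-- The formula `φ(x̄, ȳ)`, with `|x̄| = |ȳ| = s`, has the `ℓ`-order-property on `G`. -/
def HasOrderPropertyOn {s : ℕ} (φ : L.Form Λ (s + s)) (ℓ : ℕ) (G : Bundled.{v} Λ.Structure) :
    Prop :=
  ∃ a : Fin ℓ → Fin s → G, ∀ i j : Fin ℓ, L.Sat φ G (Fin.append (a i) (a j)) ↔ i ≤ j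

/-- The formula `φ(x̄, ȳ)` has the order-property on the class `C`. -/
def HasOrderProperty {s : ℕ} (φ : L.Form Λ (s + s)) (C : Set (Bundled.{v} Λ.Structure)) : Prop :=
  ∀ ℓ : ℕ, ∃ G ∈ C, L.HasOrderPropertyOn φ ℓ G

/-- A class is `L`-stable if no formula has the order-property on it. -/
def IsStable (C : Set (Bundled.{v} Λ.Structure)) : Prop :=
  ∀ (s : ℕ) (φ : L.Form Λ (s + s)), ¬ L.HasOrderProperty φ C

/-- A class is monadically `L`-stable if for every `k` the class of its `k`-colorings is
`L`-stable. -/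
def IsMonadicallyStable (C : Set (Bundled.{v} Λ.Structure)) : Prop :=
  ∀ k : ℕ, L.IsStable (colorings C k)

/-! ## Interpretations and transductions -/

/-- A one-dimensional `L`-interpretation from `Λ₁` to `Λ₂`. -/
structure Interpretation (L : AbstractLogic.{u, v, w}) (Λ₁ : FirstOrder.Language.{0, u}) [Λ₁.IsRelational]
    (Λ₂ : FirstOrder.Language) [Λ₂.IsRelational] where
  /-- the domain formula -/
  dom : L.Form Λ₁ 1
  /-- one formula for every relation symbol of the target signature -/
  rel : ∀ {n : ℕ}, Λ₂.Relations n → L.Form Λ₁ n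

/-- The structure `I(G)`: its universe consists of the elements of `G` satisfying the domain
formula, its relations are defined in `G` by the formulas of the interpretation. -/
def Interpretation.apply {L : AbstractLogic.{u, v, w}} {Λ₁ : FirstOrder.Language.{0, u}} [Λ₁.IsRelational]
    {Λ₂ : FirstOrder.Language} [Λ₂.IsRelational] (I : L.Interpretation Λ₁ Λ₂)
    (G : Bundled.{v} Λ₁.Structure) : Bundled.{v} Λ₂.Structure where
  α := {b : G // L.Sat I.dom G ![b]}
  str :=
    { funMap := fun f => isEmptyElim f
      RelMap := fun R b => L.Sat (I.rel R) G (fun i => (b i : G)) }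

/-- An `L`-transduction from `Λ₁` to `Λ₂`: a number `k` of colors and an interpretation from
`Λ₁^(k)` to `Λ₂`. -/
structure Transduction (L : AbstractLogic.{u, v, w}) (Λ₁ : FirstOrder.Language.{0, u}) [Λ₁.IsRelational]
    (Λ₂ : FirstOrder.Language) [Λ₂.IsRelational] where
  numColors : ℕ
  interp : L.Interpretation (colored Λ₁ numColors) Λ₂

/-- The class `T(C)` of all structures (isomorphic to) `I_T(G⁺)`, where `G⁺` is a coloring of a
structure from `C`. -/
def Transduction.image {L : AbstractLogic.{u, v, w}} {Λ₁ : FirstOrder.Language.{0, u}} [Λ₁.IsRelational]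
    {Λ₂ : FirstOrder.Language} [Λ₂.IsRelational] (T : L.Transduction Λ₁ Λ₂)
    (C : Set (Bundled.{v} Λ₁.Structure)) : Set (Bundled.{v} Λ₂.Structure) :=
  {H | ∃ G ∈ colorings C T.numColors, Nonempty (T.interp.apply G ≃[Λ₂] H)}

/-- The class `C` `L`-transduces the class `D`. -/
def Transduces {Λ₂ : FirstOrder.Language} [Λ₂.IsRelational]
    (C : Set (Bundled.{v} Λ.Structure)) (D : Set (Bundled.{v} Λ₂.Structure)) : Prop :=
  ∃ T : L.Transduction Λ Λ₂, D ⊆ T.image C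

end AbstractLogic

/-! ## Half-graphs -/

/-- The half-graph of order `t`, with vertices `a_i = Sum.inl i` and `b_j = Sum.inr j`, where
`a_i` and `b_j` are adjacent if and only if `i ≤ j`. -/
def halfGraph (t : ℕ) : SimpleGraph (Fin t ⊕ Fin t) where
  Adj
    | .inl i, .inr j => i ≤ j
    | .inr j, .inl i => i ≤ j
    | _, _ => False
  symm := ⟨by rintro (i | i) (j | j) h <;> exact h⟩
  loopless := ⟨by rintro (i | i) h <;> exact h⟩

/-- The class of all half-graphs, as structures over the signature of graphs (closed under
isomorphism). -/
def halfGraphs : Set (Bundled.{v} FirstOrder.Language.graph.Structure) :=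
  {H | ∃ t : ℕ, Nonempty (letI := (halfGraph t).structure; H ≃[FirstOrder.Language.graph] (Fin t ⊕ Fin t))}

/-!
FO extends FO because a formula may be substituted for a relation symbol, after its free variables
are renamed to the arguments of the atom; the same works when the substituted formula is a monadic
second-order one.

If half-graphs are transduced, then the formula for their edges orders the pairs `(aᵢ, bᵢ)` in
colorings of the class, so that the class is not monadically stable.

Conversely, let `φ(x̄, ȳ)` have the order-property on colorings of the class. Compactness is not
available in the logic, and its formulas can only be used as black boxes inside first-order ones.
The heart of the proof, `HasBipartiteOrder.step`, shortens the tuples at the expense of more colors.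
Split `āᵢ` into one entry `cᵢ` and the remaining tuple, still denoted `aᵢ`. By Ramsey's theorem for
triples (`exists_homogeneous`), the truth of `φ(aᵢ, cₘ; bⱼ)` for distinct `i`, `m`, `j` depends only
on their order type, while `φ(aᵢ, cᵢ; bⱼ)` holds for `i < j` and fails for `j < i`.

* If, for `j` beyond `i` and `m` or for `j` before both, the truth value distinguishes `i < m` from
  `m < i`, then a fixed `bⱼ` makes `φ` an order between the `aᵢ` and the `cₘ`.
* If it is always false for `j` beyond `i ≠ m`, or always true for `j` before both, then a fixed
  `bⱼ` makes `φ` define the matching of `aᵢ` with `cᵢ`. So `cᵢ` can be quantified: the order is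
  defined between the `aᵢ` and the `bⱼ`.
* Otherwise `φ` holds for `i < m < j` and fails for `j < i < m`. If it holds for `i < j < m`, then a
  fixed last `cₘ` gives an order between the `aᵢ` and the `bⱼ`. If it fails there, then a fixed
  first `aᵢ` gives an order between the `cₘ` and the `bⱼ`.

Fixed tuples and the range of the quantifier are marked by new colors
(`ExtendsFO.exists_form_of_params`). Iterating this leads to an order between two sequences of
single elements (`HasBipartiteOrder.to_unit`), from which half-graphs are transduced
(`HasBipartiteOrder.transduces`).
-/

/-! ### Substituting a formula for a relation symbol -/

namespace FirstOrder.Language.Term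

/-- The variable that a term over a relational signature consists of. -/
def toVar {Λ : Language.{0, u}} [Λ.IsRelational] {α : Type*} : Λ.Term α → α
  | .var x => x
  | .func f _ => isEmptyElim f

theorem realize_eq_toVar {Λ : Language.{0, u}} [Λ.IsRelational] {α M : Type*} [Λ.Structure M]
    (t : Λ.Term α) (a : α → M) : t.realize a = a t.toVar := by
  cases t with
  | var x => rfl
  | func f _ => exact isEmptyElim f

end FirstOrder.Language.Term

/-- The result of replacing the symbol `R` by the formula `ρ` in a first-order formula over
`Λ ∪ {R}`. -/
def FirstOrder.Language.Formula.substRel {Λ : Language.{0, u}} [Λ.IsRelational] {r : ℕ}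
    (ρ : Λ.Formula (Fin r)) {α : Type} : {l : ℕ} →
    (Λ.sum (oneRelLanguage r)).BoundedFormula α l → Λ.BoundedFormula α l
  | _, .falsum => .falsum
  | _, .equal t s => .equal (.var t.toVar) (.var s.toVar)
  | _, .rel (.inl R) ts => .rel R fun i => .var (ts i).toVar
  | _, .rel (.inr .symb) ts => BoundedFormula.relabel (fun i => (ts i).toVar) ρ
  | _, .imp φ ψ => .imp (substRel ρ φ) (substRel ρ ψ)
  | _, .all φ => .all (substRel ρ φ)

theorem FirstOrder.Language.Formula.realize_substRel {Λ : Language.{0, u}} [Λ.IsRelational]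
    {r : ℕ} (ρ : Λ.Formula (Fin r)) {α : Type} {l : ℕ}
    (φ : (Λ.sum (oneRelLanguage r)).BoundedFormula α l) (M : Bundled.{v} Λ.Structure)
    (a : α → M) (b : Fin l → M) :
    (ρ.substRel φ).Realize a b ↔
      BoundedFormula.Realize (M := expandByRel M (fun x => ρ.Realize x)) φ a b := by
  induction φ with
  | falsum => rfl
  | equal t s =>
    simp only [substRel, BoundedFormula.Realize, Term.realize_eq_toVar]
    rfl
  | rel R ts =>
    rcases R with R | R
    · simp only [substRel, BoundedFormula.Realize, Term.realize_eq_toVar]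
      rfl
    · change OneRel r _ at R
      cases R
      simp only [substRel, BoundedFormula.Realize, Term.realize_eq_toVar]
      refine (BoundedFormula.realize_relabel (m := _) (n := 0)).trans ?_
      change _ ↔ ρ.Realize _
      rw [Formula.Realize, iff_eq_eq]
      exact congrArg₂ _ rfl (Subsingleton.elim _ _)
  | imp φ ψ ih₁ ih₂ => exact imp_congr (ih₁ b) (ih₂ b)
  | all φ ih => exact forall_congr' fun x => ih _

theorem FO_extendsFO : FO.{u, v}.ExtendsFO := fun _ _ _ ρ _ φ =>
  ⟨FirstOrder.Language.Formula.substRel ρ φ, fun M a =>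
    FirstOrder.Language.Formula.realize_substRel ρ φ M a _⟩

/-- The extension, to the variables available below a quantifier, of a renaming of first-order
variables. -/
def liftRenaming {n n' : ℕ} (g : Fin n → Fin n') : Fin (n + 1) → Fin (n' + 1) :=
  Fin.snoc (fun i => (g i).castSucc) (Fin.last n')

theorem snoc_comp_liftRenaming {M : Type v} {n n' : ℕ} (g : Fin n → Fin n') (a : Fin n' → M)
    (b : M) : (Fin.snoc a b : Fin (n' + 1) → M) ∘ liftRenaming g
      = (Fin.snoc (a ∘ g) b : Fin (n + 1) → M) := by
  funext i
  refine Fin.lastCases ?_ (fun j => ?_) i <;> simp [liftRenaming]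

namespace MonadicFormula

variable {counting : Prop} {Λ : FirstOrder.Language.{0, u}}

/-- Renaming the free first-order variables of a monadic formula. -/
def relabel : {n n' m : ℕ} → (Fin n → Fin n') → MonadicFormula counting Λ n m →
    MonadicFormula counting Λ n' m
  | _, _, _, _, .falsum => .falsum
  | _, _, _, g, .equal i j => .equal (g i) (g j)
  | _, _, _, g, .rel R x => .rel R (fun i => g (x i))
  | _, _, _, g, .mem i X => .mem (g i) X
  | _, _, _, _, .card hc r k hrk X => .card hc r k hrk X
  | _, _, _, g, .imp φ ψ => .imp (φ.relabel g) (ψ.relabel g)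
  | _, _, _, g, .all φ => .all (φ.relabel (liftRenaming g))
  | _, _, _, g, .allSet φ => .allSet (φ.relabel g)

theorem realize_relabel {M : Type v} [Λ.Structure M] {n n' m : ℕ} (g : Fin n → Fin n')
    (φ : MonadicFormula counting Λ n m) (a : Fin n' → M) (A : Fin m → Set M) :
    (φ.relabel g).Realize a A ↔ φ.Realize (a ∘ g) A := by
  induction φ generalizing n' with
  | falsum => rfl
  | equal i j => rfl
  | rel R x => rfl
  | mem i X => rfl
  | card hc r k hrk X => rfl
  | imp φ ψ ih₁ ih₂ => exact imp_congr (ih₁ ..) (ih₂ ..)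
  | all φ ih =>
    refine forall_congr' fun b => (ih ..).trans ?_
    rw [snoc_comp_liftRenaming]
  | allSet φ ih => exact forall_congr' fun B => ih ..

/-- The result of replacing the symbol `R` by the monadic formula `ρ` in a first-order formula over
`Λ ∪ {R}`. The free variables of the first-order formula come first, followed by its bound
ones. -/
def substRel [Λ.IsRelational] {r : ℕ} (ρ : MonadicFormula counting Λ r 0) {n : ℕ} : {l : ℕ} →
    (Λ.sum (oneRelLanguage r)).BoundedFormula (Fin n) l → MonadicFormula counting Λ (n + l) 0
  | _, .falsum => .falsum
  | _, .equal t s => .equal (finSumFinEquiv t.toVar) (finSumFinEquiv s.toVar)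
  | _, .rel (.inl R) ts => .rel R fun i => finSumFinEquiv (ts i).toVar
  | _, .rel (.inr .symb) ts => ρ.relabel fun i => finSumFinEquiv (ts i).toVar
  | _, .imp φ ψ => .imp (substRel ρ φ) (substRel ρ ψ)
  | l, .all φ => .all (n := n + l) (substRel ρ (n := n) (l := l + 1) φ)

theorem realize_substRel [Λ.IsRelational] {r : ℕ} (ρ : MonadicFormula counting Λ r 0) {n l : ℕ}
    (φ : (Λ.sum (oneRelLanguage r)).BoundedFormula (Fin n) l) (M : Bundled.{v} Λ.Structure)
    (a : Fin n → M) (b : Fin l → M) :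
    (ρ.substRel φ).Realize (Fin.append a b) Fin.elim0 ↔
      FirstOrder.Language.BoundedFormula.Realize
        (M := expandByRel M (fun x => ρ.Realize x Fin.elim0)) φ a b := by
  have key : ∀ {l : ℕ} (b : Fin l → M) (x : Fin n ⊕ Fin l),
      Fin.append a b (finSumFinEquiv x) = Sum.elim a b x := by
    rintro l b (x | x) <;> simp
  induction φ with
  | falsum => rfl
  | equal t s =>
    simp only [substRel, Realize, FirstOrder.Language.BoundedFormula.Realize,
      FirstOrder.Language.Term.realize_eq_toVar, key]
  | rel R ts =>
    rcases R with R | R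
    · simp only [substRel, Realize, FirstOrder.Language.BoundedFormula.Realize,
        FirstOrder.Language.Term.realize_eq_toVar, key]
      rfl
    · change OneRel r _ at R
      cases R
      simp only [substRel, realize_relabel, FirstOrder.Language.BoundedFormula.Realize,
        FirstOrder.Language.Term.realize_eq_toVar, Function.comp_def, key]
      rfl
  | imp φ ψ ih₁ ih₂ => exact imp_congr (ih₁ b) (ih₂ b)
  | all φ ih =>
    refine forall_congr' fun x => ?_
    have := ih (Fin.snoc b x)
    rwa [Fin.append_snoc] at this

end MonadicFormula

theorem monadicLogic_extendsFO (counting : Prop) : (monadicLogic.{u, v} counting).ExtendsFO :=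
  fun _ _ _ ρ _ φ => ⟨MonadicFormula.substRel ρ φ, fun M a => by
    have := MonadicFormula.realize_substRel ρ φ M a Fin.elim0
    rw [Fin.append_elim0] at this
    exact this⟩

/-! ### Ramsey's theorem for triples -/

/-- A form of Ramsey's theorem for triples, for finitely many predicates `χ l` on the triples of
natural numbers below `l`. There is a single pattern `c` such that arbitrarily long increasing
sequences below suitable `l` have this pattern on all their increasing triples. -/
theorem exists_homogeneous {S : Type*} [Finite S] (χ : ℕ → ℕ → ℕ → ℕ → S → Prop) :
    ∃ c : S → Prop, ∀ t : ℕ, ∃ (l : ℕ) (f : ℕ → ℕ), (∀ i < t, f i < l) ∧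
      (∀ i j, i < j → j < t → f i < f j) ∧
      ∀ i j k, i < j → j < k → k < t → ∀ s, χ l (f i) (f j) (f k) s ↔ c s := by
  -- The pattern is the iterated limit of `χ` along a non-principal ultrafilter.
  let U : Filter ℕ := Filter.hyperfilter ℕ
  have hU : ∀ n, ∀ᶠ x in U, n < x := fun n =>
    Filter.Tendsto.eventually Nat.hyperfilter_le_atTop (Filter.eventually_gt_atTop n)
  have em : ∀ p : ℕ → Prop, ∀ᶠ x in U, (p x ↔ ∀ᶠ y in U, p y) := fun p => by
    rcases (Filter.hyperfilter ℕ).em p with h | h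
    · exact h.mono fun x hx => iff_of_true hx h
    · exact h.mono fun x hx => iff_of_false hx (Ultrafilter.eventually_not.1 h)
  let c : S → Prop := fun s => ∀ᶠ x in U, ∀ᶠ y in U, ∀ᶠ z in U, ∀ᶠ l in U, χ l x y z s
  let Q3 : ℕ → ℕ → ℕ → Prop := fun x y z => ∀ᶠ l in U, ∀ s, χ l x y z s ↔ c s
  let Q2 : ℕ → ℕ → Prop := fun x y => ∀ᶠ z in U, Q3 x y z
  let Q1 : ℕ → Prop := fun x => ∀ᶠ y in U, Q2 x y
  have hQ : ∀ᶠ x in U, Q1 x := by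
    have h1 := Filter.eventually_all.2 fun s =>
      em fun x => ∀ᶠ y in U, ∀ᶠ z in U, ∀ᶠ l in U, χ l x y z s
    refine h1.mono fun x h1 => ?_
    have h2 := Filter.eventually_all.2 fun s => em fun y => ∀ᶠ z in U, ∀ᶠ l in U, χ l x y z s
    refine h2.mono fun y h2 => ?_
    have h3 := Filter.eventually_all.2 fun s => em fun z => ∀ᶠ l in U, χ l x y z s
    refine h3.mono fun z h3 => ?_
    have h4 := Filter.eventually_all.2 fun s => em fun l => χ l x y z s
    exact h4.mono fun l h4 s => (h4 s).trans ((h3 s).trans ((h2 s).trans (h1 s)))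
  have hseq : ∀ t : ℕ, ∃ f : ℕ → ℕ, (∀ i < t, Q1 (f i)) ∧
      (∀ i < t, ∀ j < t, i < j → f i < f j ∧ Q2 (f i) (f j)) ∧
      ∀ i < t, ∀ j < t, ∀ k < t, i < j → j < k → Q3 (f i) (f j) (f k) := by
    intro t
    induction t with
    | zero => exact ⟨id, by simp⟩
    | succ t ih =>
      obtain ⟨f, h1, h2, h3⟩ := ih
      have e1 : ∀ᶠ x in U, ∀ i ∈ Set.Iio t, f i < x ∧ Q2 (f i) x :=
        (Set.finite_Iio t).eventually_all.2 fun i hi => (hU _).and (h1 i hi)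
      have e2 : ∀ᶠ x in U, ∀ i ∈ Set.Iio t, ∀ j ∈ Set.Iio t, i < j → Q3 (f i) (f j) x := by
        refine (Set.finite_Iio t).eventually_all.2 fun i hi => ?_
        refine (Set.finite_Iio t).eventually_all.2 fun j hj => ?_
        by_cases hij : i < j
        · exact (h2 i hi j hj hij).2.mono fun x hx _ => hx
        · exact Filter.Eventually.of_forall fun x h => absurd h hij
      obtain ⟨x, ⟨hx0, hx1⟩, hx2⟩ := ((hQ.and e1).and e2).exists
      have hlt : ∀ {i}, i < t → Function.update f t x i = f i := fun hi =>
        Function.update_of_ne hi.ne _ _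
      refine ⟨Function.update f t x, fun i hi => ?_, fun i hi j hj hij => ?_,
        fun i hi j hj k hk hij hjk => ?_⟩
      · rcases Nat.lt_succ_iff_lt_or_eq.1 hi with hi | rfl
        · rw [hlt hi]; exact h1 i hi
        · simpa using hx0
      · have hi : i < t := by omega
        rw [hlt hi]
        rcases Nat.lt_succ_iff_lt_or_eq.1 hj with hj | rfl
        · rw [hlt hj]; exact h2 i hi j hj hij
        · simpa using hx1 i hi
      · have hi : i < t := by omega
        have hj : j < t := by omega
        rw [hlt hi, hlt hj]
        rcases Nat.lt_succ_iff_lt_or_eq.1 hk with hk | rfl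
        · rw [hlt hk]; exact h3 i hi j hj k hk hij hjk
        · simpa using hx2 i hi j hj hij
  refine ⟨c, fun t => ?_⟩
  obtain ⟨f, -, h2, h3⟩ := hseq t
  have e1 : ∀ᶠ l in U, ∀ i ∈ Set.Iio t, f i < l :=
    (Set.finite_Iio t).eventually_all.2 fun i _ => hU _
  have e2 : ∀ᶠ l in U, ∀ i ∈ Set.Iio t, ∀ j ∈ Set.Iio t, ∀ k ∈ Set.Iio t, i < j → j < k →
      ∀ s, χ l (f i) (f j) (f k) s ↔ c s := by
    refine (Set.finite_Iio t).eventually_all.2 fun i hi => ?_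
    refine (Set.finite_Iio t).eventually_all.2 fun j hj => ?_
    refine (Set.finite_Iio t).eventually_all.2 fun k hk => ?_
    by_cases h : i < j ∧ j < k
    · exact (h3 i hi j hj k hk h.1 h.2).mono fun x hx _ _ => hx
    · exact Filter.Eventually.of_forall fun x h1 h2 => absurd ⟨h1, h2⟩ h
  obtain ⟨l, hl1, hl2⟩ := (e1.and e2).exists
  exact ⟨l, f, hl1, fun i j hij hj => (h2 i (hij.trans hj) j hj hij).1,
    fun i j k hij hjk hk => hl2 i (hij.trans (hjk.trans hk)) j (hjk.trans hk) k hk hij hjk⟩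

/-! ### Adding colors -/

section AddColors

open FirstOrder.Language

variable {Λ : FirstOrder.Language.{0, u}}

/-- The structure over the signature of `k` unary predicates in which the `i`-th one is interpreted
as the set `P i`. -/
abbrev colorStructure {k : ℕ} {M : Type v} (P : Fin k → Set M) : (colorLanguage k).Structure M where
  funMap := fun f => f.elim
  RelMap := fun {_} R => match R with
    | .color i => fun x => x 0 ∈ P i

/-- The `i`-th color class of a `k`-colored structure. -/
def colorClass {k : ℕ} (G : Bundled.{v} (colored Λ k).Structure) (i : Fin k) : Set G :=
  {x | Structure.RelMap (L := colored Λ k) (Sum.inr (.color i)) (fun _ : Fin 1 => x)}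

/-- The expansion of a `k`-colored structure by `q` further colors, the sets `Z_0, …, Z_{q-1}`. -/
abbrev addColors {k q : ℕ} (G : Bundled.{v} (colored Λ k).Structure) (Z : Fin q → Set G) :
    Bundled.{v} (colored Λ (k + q)).Structure :=
  ⟨G, @sumStructure Λ (colorLanguage (k + q)) G ((LHom.sumInl : Λ →ᴸ colored Λ k).reduct G)
    (colorStructure (Fin.append (colorClass G) Z))⟩

theorem addColors_mem_colorings {C : Set (Bundled.{v} Λ.Structure)} {k q : ℕ}
    {G : Bundled.{v} (colored Λ k).Structure} (hG : G ∈ colorings C k) (Z : Fin q → Set G) :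
    addColors G Z ∈ colorings C (k + q) :=
  hG

/-- The inclusion of the signature with `k` colors into the one with `k + q` colors. -/
def colorInclusion (Λ : FirstOrder.Language.{0, u}) (k q : ℕ) : colored Λ k →ᴸ colored Λ (k + q) :=
  LHom.sumMap (LHom.id Λ)
    { onFunction := fun _ f => f.elim
      onRelation := fun _ R => match R with
        | .color i => .color (Fin.castAdd q i) }

theorem colorInclusion_injective (k q : ℕ) : (colorInclusion Λ k q).Injective where
  onFunction := by
    rintro n (f | f) (g | g) h
    · exact congrArg Sum.inl (Sum.inl_injective h)
    · exact g.elim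
    · exact f.elim
    · exact f.elim
  onRelation := by
    rintro n (R | R) (S | S) h
    · exact congrArg Sum.inl (Sum.inl_injective h)
    · simp [colorInclusion, LHom.sumMap] at h
    · simp [colorInclusion, LHom.sumMap] at h
    · change ColorRel k n at R S
      cases R
      cases S
      have := ColorRel.color.inj (Sum.inr_injective h)
      rw [Fin.castAdd_injective k q this]

theorem reduct_addColors [Λ.IsRelational] {k q : ℕ} (G : Bundled.{v} (colored Λ k).Structure)
    (Z : Fin q → Set G) : (colorInclusion Λ k q).reduct (addColors G Z) = G.str := by
  refine Language.Structure.ext ?_ ?_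
  · funext n f
    exact isEmptyElim f
  · funext n R x
    rcases R with R | R
    · rfl
    · change ColorRel k n at R
      cases R with
      | color i =>
        change (x 0 ∈ Fin.append (colorClass G) Z (Fin.castAdd q i)) = _
        rw [Fin.append_left]
        exact congrArg _ (funext fun j => congrArg x (Subsingleton.elim _ _))

/-- The atomic formula saying that `x` has the `j`-th one of the `q` last colors. -/
def colorFormula {k q r : ℕ} {γ : Type} (j : Fin q) (x : γ) :
    ((colored Λ (k + q)).sum (oneRelLanguage r)).Formula γ :=
  Relations.formula (n := 1) (Sum.inl (Sum.inr (.color (Fin.natAdd k j)))) fun _ => .var x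

/-- The atomic formula `R(x̄)`. -/
def oneRelFormula {Λ : FirstOrder.Language.{0, u}} {r : ℕ} {γ : Type} (x : Fin r → γ) :
    (Λ.sum (oneRelLanguage r)).Formula γ :=
  Relations.formula (Sum.inr .symb) fun i => .var (x i)

theorem realize_colorFormula {k q r : ℕ} {γ : Type} {G : Bundled.{v} (colored Λ k).Structure}
    {Z : Fin q → Set G} {P : (Fin r → G) → Prop} (j : Fin q) (x : γ) (a : γ → G) :
    Formula.Realize (M := expandByRel (addColors G Z) P)
      (colorFormula j x : ((colored Λ (k + q)).sum (oneRelLanguage r)).Formula γ) a ↔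
        a x ∈ Z j := by
  refine Formula.realize_rel.trans ?_
  change a x ∈ Fin.append (colorClass G) Z (Fin.natAdd k j) ↔ _
  rw [Fin.append_right]

theorem realize_oneRelFormula {r : ℕ} {γ : Type} {G : Bundled.{v} Λ.Structure}
    {P : (Fin r → G) → Prop} (x : Fin r → γ) (a : γ → G) :
    Formula.Realize (M := expandByRel G P)
      (oneRelFormula x : (Λ.sum (oneRelLanguage r)).Formula γ) a ↔ P (a ∘ x) :=
  Formula.realize_rel (L := Λ.sum (oneRelLanguage r)) (M := expandByRel G P)

end AddColors

namespace AbstractLogic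

open FirstOrder.Language

variable {L : AbstractLogic.{u, v, w}} {Λ : FirstOrder.Language.{0, u}} [Λ.IsRelational]

/-- A formula of a logic extending FO may be used inside a first-order formula that refers to
additional colors. -/
theorem ExtendsFO.exists_form (hL : L.ExtendsFO) {k p : ℕ} (φ : L.Form (colored Λ k) p)
    {q n : ℕ} (θ : ((colored Λ (k + q)).sum (oneRelLanguage p)).Formula (Fin n)) :
    ∃ φ' : L.Form (colored Λ (k + q)) n, ∀ (G : Bundled.{v} (colored Λ k).Structure)
      (Z : Fin q → Set G) (a : Fin n → G), L.Sat φ' (addColors G Z) a ↔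
        θ.Realize (M := expandByRel (addColors G Z) (L.Sat φ G)) a := by
  obtain ⟨ρ, hρ⟩ := L.exists_expansion _ (colorInclusion_injective (Λ := Λ) k q) φ
  obtain ⟨φ', hφ'⟩ := hL _ p ρ n θ
  refine ⟨φ', fun G Z a => (hφ' (addColors G Z) a).trans ?_⟩
  have h : L.Sat ρ (addColors G Z) = L.Sat φ G := by
    funext b
    refine (propext (hρ _ b)).trans ?_
    exact congrArg (fun S : (colored Λ k).Structure G => L.Sat φ ⟨G, S⟩ b) (reduct_addColors G Z)
  exact iff_of_eq (congrArg
    (fun P : (Fin p → G) → Prop => θ.Realize (M := expandByRel (addColors G Z) P) a) h)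

/-- The formulas of a logic extending FO are closed under conjunction, negation and quantification
over color classes. Each quantified variable ranges over a set, which becomes a new color. If the
set is a singleton, its element serves as a parameter. -/
theorem ExtendsFO.exists_form_of_params (hL : L.ExtendsFO) {k p : ℕ}
    (φ : L.Form (colored Λ k) p) {γ δ : Type} [Finite γ] [Finite δ] (σ₁ σ₂ : Fin p → γ ⊕ δ)
    (ε₁ ε₂ : Prop) :
    ∃ (q p' : ℕ) (φ' : L.Form (colored Λ (k + q)) p') (τ : Fin p' → γ) (e : Fin q → δ),
      ∀ (G : Bundled.{v} (colored Λ k).Structure) (Z : δ → Set G) (a : γ → G),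
        L.Sat φ' (addColors G (Z ∘ e)) (a ∘ τ) ↔
          ∃ z : δ → G, (∀ d, z d ∈ Z d) ∧ (L.Sat φ G (Sum.elim a z ∘ σ₁) ↔ ε₁) ∧
            (L.Sat φ G (Sum.elim a z ∘ σ₂) ↔ ε₂) := by
  classical
  let q := Nat.card δ
  let e : Fin q ≃ δ := (Finite.equivFin δ).symm
  let n := Nat.card γ
  let τ : Fin n ≃ γ := (Finite.equivFin γ).symm
  let literal : (Fin p → γ ⊕ δ) → Prop →
      ((colored Λ (k + q)).sum (oneRelLanguage p)).Formula (Fin n ⊕ δ) := fun σ ε =>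
    if ε then oneRelFormula (Sum.map τ.symm id ∘ σ)
    else (oneRelFormula (Sum.map τ.symm id ∘ σ)).not
  let θ : ((colored Λ (k + q)).sum (oneRelLanguage p)).Formula (Fin n) :=
    Formula.iExs δ ((Formula.iInf fun d => colorFormula (e.symm d) (Sum.inr d)) ⊓
      (literal σ₁ ε₁ ⊓ literal σ₂ ε₂))
  obtain ⟨φ', hφ'⟩ := hL.exists_form φ θ
  refine ⟨q, n, φ', τ, e, fun G Z a => (hφ' G (Z ∘ e) (a ∘ τ)).trans ?_⟩
  have hat : ∀ (σ : Fin p → γ ⊕ δ) (ε : Prop) (z : δ → G),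
      Formula.Realize (M := expandByRel (addColors G (Z ∘ e)) (L.Sat φ G)) (literal σ ε)
        (Sum.elim (a ∘ τ) z) ↔ (L.Sat φ G (Sum.elim a z ∘ σ) ↔ ε) := by
    intro σ ε z
    have key : Sum.elim (a ∘ τ) z ∘ Sum.map τ.symm id ∘ σ = Sum.elim a z ∘ σ := by
      funext i
      simp only [Function.comp_apply]
      rcases σ i with x | x <;> simp
    have := realize_oneRelFormula (G := addColors G (Z ∘ e)) (P := L.Sat φ G)
      (Sum.map τ.symm id ∘ σ) (Sum.elim (a ∘ τ) z)
    rw [key] at this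
    by_cases hε : ε
    · simpa only [literal, hε, if_true, iff_true] using this
    · simp only [literal, hε, if_false, iff_false]
      exact (Formula.realize_not (M := expandByRel (addColors G (Z ∘ e)) (L.Sat φ G))).trans
        (not_congr this)
  refine Formula.realize_iExs.trans (exists_congr fun z => ?_)
  refine Formula.realize_inf.trans (and_congr ?_ ?_)
  · refine Formula.realize_iInf.trans (forall_congr' fun d => ?_)
    refine (realize_colorFormula _ _ _).trans ?_
    simp
  · exact Formula.realize_inf.trans (and_congr (hat ..) (hat ..))

/-! ### From tuples to single elements -/

/-- For some number of colors, a formula orders arbitrarily long pairs of sequences of an `α`-tuple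
and a `β`-tuple each, in colorings of structures from `C`: it holds for the `i`-th `α`-tuple and
the `j`-th `β`-tuple if `i < j`, and fails if `j < i`. Nothing is required for `i = j`, and the
sequences are indexed by all natural numbers, although only the first `l` entries matter. -/
def HasBipartiteOrder (L : AbstractLogic.{u, v, w}) (C : Set (Bundled.{v} Λ.Structure))
    (α β : Type) : Prop :=
  ∃ (k p : ℕ) (φ : L.Form (colored Λ k) p) (σ : Fin p → α ⊕ β), ∀ l : ℕ, ∃ G ∈ colorings C k,
    ∃ (a : ℕ → α → G) (b : ℕ → β → G), ∀ i j, i < j → j < l →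
      L.Sat φ G (Sum.elim (a i) (b j) ∘ σ) ∧ ¬ L.Sat φ G (Sum.elim (a j) (b i) ∘ σ)

variable {C : Set (Bundled.{v} Λ.Structure)} {α β : Type}

theorem HasBipartiteOrder.symm (h : L.HasBipartiteOrder C α β) : L.HasBipartiteOrder C β α := by
  obtain ⟨k, p, φ, σ, h⟩ := h
  refine ⟨k, p, φ, Sum.swap ∘ σ, fun l => ?_⟩
  obtain ⟨G, hG, a, b, hab⟩ := h (l + 1)
  refine ⟨G, hG, fun i => b (l - i), fun i => a (l - i), fun i j hij hj => ?_⟩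
  have key : ∀ (x : α → G) (y : β → G), Sum.elim y x ∘ Sum.swap ∘ σ = Sum.elim x y ∘ σ := by
    intro x y
    funext i
    simp only [Function.comp_apply]
    rcases σ i with x | x <;> rfl
  rw [key, key]
  exact hab (l - j) (l - i) (by omega) (by omega)

theorem HasBipartiteOrder.congr_left {α' : Type} (e : α ≃ α') (h : L.HasBipartiteOrder C α β) :
    L.HasBipartiteOrder C α' β := by
  obtain ⟨k, p, φ, σ, h⟩ := h
  refine ⟨k, p, φ, Sum.map e id ∘ σ, fun l => ?_⟩
  obtain ⟨G, hG, a, b, hab⟩ := h l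
  refine ⟨G, hG, fun i => a i ∘ e.symm, b, fun i j hij hj => ?_⟩
  have key : ∀ (x : α → G) (y : β → G),
      Sum.elim (x ∘ e.symm) y ∘ Sum.map e id ∘ σ = Sum.elim x y ∘ σ := by
    intro x y
    funext i
    simp only [Function.comp_apply]
    rcases σ i with x | x <;> simp
  rw [key, key]
  exact hab i j hij hj

theorem HasBipartiteOrder.nonempty_left (h : L.HasBipartiteOrder C α β) : Nonempty α := by
  obtain ⟨k, p, φ, σ, h⟩ := h
  by_contra hα
  rw [not_nonempty_iff] at hα
  obtain ⟨G, -, a, b, hab⟩ := h 3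
  -- All `α`-tuples agree, so that the same instance of `φ` is required to hold and to fail.
  have h1 := (hab 0 1 (by omega) (by omega)).1
  have h2 := (hab 1 2 (by omega) (by omega)).2
  rw [Subsingleton.elim (a 0) (a 2)] at h1
  exact h2 h1

/-- A bipartite order may be defined by a formula of the shape treated in
`ExtendsFO.exists_form_of_params`. -/
theorem HasBipartiteOrder.of_params (hL : L.ExtendsFO) {k p : ℕ} (φ : L.Form (colored Λ k) p)
    {δ : Type} [Finite α] [Finite β] [Finite δ] (σ₁ σ₂ : Fin p → (α ⊕ β) ⊕ δ) (ε₁ ε₂ : Prop)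
    (h : ∀ l : ℕ, ∃ G ∈ colorings C k, ∃ (a : ℕ → α → G) (b : ℕ → β → G) (Z : δ → Set G),
      ∀ i j, i < j → j < l →
        (∃ z : δ → G, (∀ d, z d ∈ Z d) ∧
          (L.Sat φ G (Sum.elim (Sum.elim (a i) (b j)) z ∘ σ₁) ↔ ε₁) ∧
          (L.Sat φ G (Sum.elim (Sum.elim (a i) (b j)) z ∘ σ₂) ↔ ε₂)) ∧
        ¬ ∃ z : δ → G, (∀ d, z d ∈ Z d) ∧
          (L.Sat φ G (Sum.elim (Sum.elim (a j) (b i)) z ∘ σ₁) ↔ ε₁) ∧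
          (L.Sat φ G (Sum.elim (Sum.elim (a j) (b i)) z ∘ σ₂) ↔ ε₂)) :
    L.HasBipartiteOrder C α β := by
  obtain ⟨q, p', φ', τ, e, hφ'⟩ := hL.exists_form_of_params φ σ₁ σ₂ ε₁ ε₂
  refine ⟨k + q, p', φ', τ, fun l => ?_⟩
  obtain ⟨G, hG, a, b, Z, hab⟩ := h l
  exact ⟨addColors G (Z ∘ e), addColors_mem_colorings hG _, a, b, fun i j hij hj =>
    ⟨(hφ' G Z _).2 (hab i j hij hj).1, fun hs => (hab i j hij hj).2 ((hφ' G Z _).1 hs)⟩⟩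

/-- A bipartite order may be defined with parameters `z` which depend on the structure. -/
theorem HasBipartiteOrder.of_const (hL : L.ExtendsFO) {k p : ℕ} (φ : L.Form (colored Λ k) p)
    {δ : Type} [Finite α] [Finite β] [Finite δ] (σ : Fin p → (α ⊕ β) ⊕ δ) (ε : Prop)
    (h : ∀ l : ℕ, ∃ G ∈ colorings C k, ∃ (a : ℕ → α → G) (b : ℕ → β → G) (z : δ → G),
      ∀ i j, i < j → j < l →
        (L.Sat φ G (Sum.elim (Sum.elim (a i) (b j)) z ∘ σ) ↔ ε) ∧
        ¬ (L.Sat φ G (Sum.elim (Sum.elim (a j) (b i)) z ∘ σ) ↔ ε)) :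
    L.HasBipartiteOrder C α β := by
  refine HasBipartiteOrder.of_params hL φ σ σ ε ε fun l => ?_
  obtain ⟨G, hG, a, b, z, hab⟩ := h l
  refine ⟨G, hG, a, b, fun d => {z d}, fun i j hij hj =>
    ⟨⟨z, fun d => rfl, (hab i j hij hj).1, (hab i j hij hj).1⟩, ?_⟩⟩
  rintro ⟨z', hz', h1, -⟩
  obtain rfl : z' = z := funext hz'
  exact (hab i j hij hj).2 h1

/-- The tuple obtained from the tuple `a` by adding the entry `c`. -/
abbrev extendTuple {M : Type v} (a : α → M) (c : M) : Option α → M := fun o => o.elim c a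

/-- The reduction of the length of the tuples. A tuple with at least one entry is split into this
entry `c` and the remaining tuple `a`. For a sequence on which the relation `φ(aᵢ, cₘ; bⱼ)` depends
only on the order type of `(i, m, j)`, either one of the three may be fixed as a parameter so that
the relation orders the other two, or a parameter `b` far out determines `cᵢ` from `aᵢ`. -/
theorem HasBipartiteOrder.step [Finite α] [Finite β] (hL : L.ExtendsFO)
    (h : L.HasBipartiteOrder C (Option α) β) :
    L.HasBipartiteOrder C α β ∨ L.HasBipartiteOrder C α Unit ∨ L.HasBipartiteOrder C Unit β := by
  obtain ⟨k, p, φ, σ, h⟩ := h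
  choose G hG a b hab using h
  let T : ∀ l : ℕ, ℕ → ℕ → ℕ → Prop := fun l i m j => L.Sat φ (G l)
    (Sum.elim (extendTuple (fun x => a l i (some x)) (a l m none)) (b l j) ∘ σ)
  -- The order types `i < m < j`, `m < i < j`, `i < j < m`, `j < i < m` and `j < m < i`.
  obtain ⟨c, hc⟩ := exists_homogeneous fun l x y z =>
    ![T l x y z, T l y x z, T l x z y, T l y z x, T l z y x]
  have hom : ∀ t, ∃ G ∈ colorings C k, ∃ (a : ℕ → α → G) (d : ℕ → G) (b : ℕ → β → G),
      let S := fun i m j => L.Sat φ G (Sum.elim (extendTuple (a i) (d m)) (b j) ∘ σ)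
      (∀ i j, i < j → j < t → S i i j ∧ ¬ S j j i) ∧
      ∀ x y z, x < y → y < z → z < t → (S x y z ↔ c 0) ∧ (S y x z ↔ c 1) ∧ (S x z y ↔ c 2) ∧
        (S y z x ↔ c 3) ∧ (S z y x ↔ c 4) := by
    intro t
    obtain ⟨l, f, hf1, hf2, hf3⟩ := hc t
    refine ⟨G l, hG l, fun i x => a l (f i) (some x), fun i => a l (f i) none,
      fun j => b l (f j), fun i j hij hj => ?_, fun x y z hxy hyz hz =>
      ⟨hf3 x y z hxy hyz hz 0, hf3 x y z hxy hyz hz 1, hf3 x y z hxy hyz hz 2,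
        hf3 x y z hxy hyz hz 3, hf3 x y z hxy hyz hz 4⟩⟩
    have key : ∀ i, extendTuple (fun x => a l i (some x)) (a l i none) = a l i := fun i => by
      funext o
      cases o <;> rfl
    simp only [key]
    exact hab l (f i) (f j) (hf2 i j hij hj) (hf1 j hj)
  clear hc hab T
  -- The three ways to regard one part of `(a, c, b)` as a parameter.
  let σc : Option α ⊕ β → (α ⊕ β) ⊕ Unit := Sum.elim
    (fun o => o.elim (Sum.inr ()) (fun x => Sum.inl (Sum.inl x))) (fun y => Sum.inl (Sum.inr y))
  let σa : Option α ⊕ β → (Unit ⊕ β) ⊕ α := Sum.elim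
    (fun o => o.elim (Sum.inl (Sum.inl ())) Sum.inr) (fun y => Sum.inl (Sum.inr y))
  let σb : Option α ⊕ β → (α ⊕ Unit) ⊕ β := Sum.elim
    (fun o => o.elim (Sum.inl (Sum.inr ())) (fun x => Sum.inl (Sum.inl x))) Sum.inr
  have elimc : ∀ {M : Type v} (a : α → M) (d : M) (b : β → M),
      Sum.elim (Sum.elim a b) (fun _ => d) ∘ σc ∘ σ = Sum.elim (extendTuple a d) b ∘ σ := by
    intro M a d b
    funext i
    simp only [Function.comp_apply]
    rcases σ i with (_ | x) | x <;> rfl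
  have elima : ∀ {M : Type v} (a : α → M) (d : M) (b : β → M),
      Sum.elim (Sum.elim (fun _ => d) b) a ∘ σa ∘ σ = Sum.elim (extendTuple a d) b ∘ σ := by
    intro M a d b
    funext i
    simp only [Function.comp_apply]
    rcases σ i with (_ | x) | x <;> rfl
  have elimb : ∀ {M : Type v} (a : α → M) (d : M) (b : β → M),
      Sum.elim (Sum.elim a (fun _ => d)) b ∘ σb ∘ σ = Sum.elim (extendTuple a d) b ∘ σ := by
    intro M a d b
    funext i
    simp only [Function.comp_apply]
    rcases σ i with (_ | x) | x <;> rfl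
  -- If `φ(aᵢ, cₘ; b)` holds only for `i = m`, or fails only for `i = m`, then `cᵢ` is definable
  -- from `aᵢ`, and `φ(aᵢ, cᵢ; bⱼ)` becomes a formula about `aᵢ` and `bⱼ`.
  have matching : ∀ ε : Prop, (∀ t, ∃ G ∈ colorings C k, ∃ (a : ℕ → α → G) (d : ℕ → G)
      (b : ℕ → β → G) (e : β → G),
      let S := fun i m y => L.Sat φ G (Sum.elim (extendTuple (a i) (d m)) y ∘ σ)
      (∀ i j, i < j → j < t → S i i (b j) ∧ ¬ S j j (b i)) ∧
      ∀ i m, i < t → m < t → ((S i m e ↔ ε) ↔ i = m)) → L.HasBipartiteOrder C α β := by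
    intro ε hε
    let σ₁ : Option α ⊕ β → (α ⊕ β) ⊕ Option β := Sum.elim
      (fun o => o.elim (Sum.inr none) (fun x => Sum.inl (Sum.inl x))) (fun y => Sum.inr (some y))
    let σ₂ : Option α ⊕ β → (α ⊕ β) ⊕ Option β := Sum.elim
      (fun o => o.elim (Sum.inr none) (fun x => Sum.inl (Sum.inl x))) (fun y => Sum.inl (Sum.inr y))
    have elim₁ : ∀ {M : Type v} (a : α → M) (b : β → M) (z : Option β → M),
        Sum.elim (Sum.elim a b) z ∘ σ₁ ∘ σ
          = Sum.elim (extendTuple a (z none)) (fun y => z (some y)) ∘ σ := by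
      intro M a b z
      funext i
      simp only [Function.comp_apply]
      rcases σ i with (_ | x) | x <;> rfl
    have elim₂ : ∀ {M : Type v} (a : α → M) (b : β → M) (z : Option β → M),
        Sum.elim (Sum.elim a b) z ∘ σ₂ ∘ σ = Sum.elim (extendTuple a (z none)) b ∘ σ := by
      intro M a b z
      funext i
      simp only [Function.comp_apply]
      rcases σ i with (_ | x) | x <;> rfl
    refine HasBipartiteOrder.of_params hL φ (σ₁ ∘ σ) (σ₂ ∘ σ) ε True fun t => ?_
    obtain ⟨G, hG, a, d, b, e, hord, hmatch⟩ := hε t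
    refine ⟨G, hG, a, b, fun o => o.elim (d '' Set.Iio t) (fun y => {e y}),
      fun i j hij hj => ⟨⟨extendTuple e (d i), ?_, ?_, ?_⟩, ?_⟩⟩
    · rintro (_ | y)
      · exact ⟨i, hij.trans hj, rfl⟩
      · exact rfl
    · rw [elim₁]
      exact (hmatch i i (hij.trans hj) (hij.trans hj)).2 rfl
    · rw [elim₂, iff_true]
      exact (hord i j hij hj).1
    · rintro ⟨z, hz, h1, h2⟩
      obtain ⟨m, hm, hzm⟩ := hz none
      have hze : (fun y => z (some y)) = e := funext fun y => hz (some y)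
      rw [elim₁, hze, ← hzm] at h1
      obtain rfl := (hmatch j m hj hm).1 h1
      rw [elim₂, ← hzm, iff_true] at h2
      exact (hord i j hij hj).2 h2
  -- If these differ, the last `bⱼ` orders the `aᵢ` and the `cₘ`.
  by_cases h01 : c 0 ↔ c 1
  swap
  · right; left
    refine HasBipartiteOrder.of_const hL φ (σb ∘ σ) (c 0) fun t => ?_
    obtain ⟨G, hG, a, d, b, -, hS⟩ := hom (t + 1)
    refine ⟨G, hG, a, fun i _ => d i, b t, fun i j hij hj => ?_⟩
    obtain ⟨h0, h1, -⟩ := hS i j t hij hj (Nat.lt_succ_self t)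
    rw [elimb, elimb]
    beta_reduce at h0 h1 ⊢
    rw [h0, h1]
    tauto
  -- If these differ, the first `bⱼ` orders the `aᵢ` and the `cₘ`.
  by_cases h34 : c 3 ↔ c 4
  swap
  · right; left
    refine HasBipartiteOrder.of_const hL φ (σb ∘ σ) (c 3) fun t => ?_
    obtain ⟨G, hG, a, d, b, -, hS⟩ := hom (t + 1)
    refine ⟨G, hG, fun i => a (i + 1), fun i _ => d (i + 1), b 0, fun i j hij hj => ?_⟩
    obtain ⟨-, -, -, h3, h4⟩ := hS 0 (i + 1) (j + 1) (by omega) (by omega) (by omega)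
    rw [elimb, elimb]
    beta_reduce at h3 h4 ⊢
    rw [h3, h4]
    tauto
  -- If this fails, the last `bⱼ` matches `aᵢ` with `cᵢ`.
  by_cases h0 : c 0
  swap
  · left
    refine matching True fun t => ?_
    obtain ⟨G, hG, a, d, b, hord, hS⟩ := hom (t + 1)
    refine ⟨G, hG, a, d, b, b t, fun i j hij hj => hord i j hij (by omega), fun i m hi hm => ?_⟩
    rw [iff_true]
    rcases lt_trichotomy i m with him | rfl | him
    · obtain ⟨h, -⟩ := hS i m t him hm (Nat.lt_succ_self t)
      exact iff_of_false (fun h' => h0 (h.1 h')) him.ne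
    · exact iff_of_true (hord i t hi (Nat.lt_succ_self t)).1 rfl
    · obtain ⟨-, h, -⟩ := hS m i t him hi (Nat.lt_succ_self t)
      exact iff_of_false (fun h' => h0 (h01.2 (h.1 h'))) him.ne'
  -- If this holds, the first `bⱼ` matches `aᵢ` with `cᵢ`.
  by_cases h3 : c 3
  · left
    refine matching False fun t => ?_
    obtain ⟨G, hG, a, d, b, hord, hS⟩ := hom (t + 1)
    refine ⟨G, hG, fun i => a (i + 1), fun i => d (i + 1), fun i => b (i + 1), b 0,
      fun i j hij hj => hord (i + 1) (j + 1) (by omega) (by omega), fun i m hi hm => ?_⟩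
    rw [iff_false]
    rcases lt_trichotomy i m with him | rfl | him
    · obtain ⟨-, -, -, h, -⟩ := hS 0 (i + 1) (m + 1) (by omega) (by omega) (by omega)
      exact iff_of_false (fun h' => h' (h.2 h3)) him.ne
    · exact iff_of_true (hord 0 (i + 1) (by omega) (by omega)).2 rfl
    · obtain ⟨-, -, -, -, h⟩ := hS 0 (m + 1) (i + 1) (by omega) (by omega) (by omega)
      exact iff_of_false (fun h' => h' (h.2 (h34.1 h3))) him.ne'
  -- The remaining order type decides between the last `cₘ` and the first `aᵢ` as a parameter.
  by_cases h2 : c 2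
  · left
    refine HasBipartiteOrder.of_const hL φ (σc ∘ σ) True fun t => ?_
    obtain ⟨G, hG, a, d, b, -, hS⟩ := hom (t + 1)
    refine ⟨G, hG, a, b, fun _ => d t, fun i j hij hj => ?_⟩
    obtain ⟨-, -, h, h', -⟩ := hS i j t hij hj (Nat.lt_succ_self t)
    rw [elimc, elimc]
    beta_reduce at h h' ⊢
    rw [h, h']
    tauto
  · right; right
    refine HasBipartiteOrder.of_const hL φ (σa ∘ σ) True fun t => ?_
    obtain ⟨G, hG, a, d, b, -, hS⟩ := hom (t + 1)
    refine ⟨G, hG, fun i _ => d (i + 1), fun i => b (i + 1), a 0, fun i j hij hj => ?_⟩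
    obtain ⟨h, -, h', -⟩ := hS 0 (i + 1) (j + 1) (by omega) (by omega) (by omega)
    rw [elima, elima]
    beta_reduce at h h' ⊢
    rw [h, h']
    tauto

/-- A bipartite order on tuples can be replaced by one on single elements. -/
theorem HasBipartiteOrder.to_unit [Finite α] [Finite β] (hL : L.ExtendsFO)
    (h : L.HasBipartiteOrder C α β) : L.HasBipartiteOrder C Unit Unit := by
  -- Induction on the total length of the tuples. The side that is shortened can be taken to be
  -- the left one, by symmetry.
  induction hn : Nat.card α + Nat.card β using Nat.strong_induction_on generalizing α β with
  | _ n ih =>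
  have key : ∀ {α β : Type} [Finite α] [Finite β], L.HasBipartiteOrder C α β →
      Nat.card α + Nat.card β = n → 2 ≤ Nat.card α → L.HasBipartiteOrder C Unit Unit := by
    intro α β _ _ h hn hα
    obtain ⟨m, hm⟩ : ∃ m, Nat.card α = m + 2 := ⟨Nat.card α - 2, by omega⟩
    let e : α ≃ Option (Fin (m + 1)) := (Finite.equivFinOfCardEq hm).trans (finSuccEquiv (m + 1))
    have hβ : Nat.card β ≠ 0 := by
      have := h.symm.nonempty_left
      exact Nat.card_pos.ne'
    rcases (h.congr_left e).step hL with h | h | h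
    · exact ih _ (by simp; omega) h rfl
    · exact ih _ (by simp; omega) h rfl
    · exact ih _ (by simp; omega) h rfl
  by_cases hα : 2 ≤ Nat.card α
  · exact key h hn hα
  by_cases hβ : 2 ≤ Nat.card β
  · exact key h.symm (by omega) hβ
  have := h.nonempty_left
  have := h.symm.nonempty_left
  have hα' : Nat.card α = 1 := by have : 0 < Nat.card α := Nat.card_pos; omega
  have hβ' : Nat.card β = 1 := by have : 0 < Nat.card β := Nat.card_pos; omega
  exact ((h.congr_left ((Finite.equivFinOfCardEq hα').trans finOneEquiv)).symm.congr_left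
    ((Finite.equivFinOfCardEq hβ').trans finOneEquiv)).symm

/-! ### Half-graphs -/

/-- The sequences of a bipartite order on single elements can be taken to be injective and disjoint
from each other. By Ramsey's theorem, whether `aᵢ = bⱼ` may be assumed to depend only on the order
of `i` and `j`. Then `aᵢ = bⱼ` never holds for `i ≠ j`, as otherwise some `aᵢ` or `bⱼ` would repeat,
contradicting the order. -/
theorem HasBipartiteOrder.exists_disjoint (h : L.HasBipartiteOrder C Unit Unit) :
    ∃ (k p : ℕ) (φ : L.Form (colored Λ k) p) (σ : Fin p → Fin 2), ∀ t : ℕ, ∃ G ∈ colorings C k,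
      ∃ V : Fin t ⊕ Fin t → G, Function.Injective V ∧
        ∀ i j, L.Sat φ G (![V (.inl i), V (.inr j)] ∘ σ) ↔ i ≤ j := by
  obtain ⟨k, p, φ, σ, h⟩ := h
  choose G hG a b hab using h
  obtain ⟨c, hc⟩ := exists_homogeneous fun l x y _ => ![a l x () = b l y (), a l y () = b l x ()]
  have hom : ∀ t, ∃ G ∈ colorings C k, ∃ (a b : ℕ → G),
      (∀ i j, i < j → j < t → L.Sat φ G (![a i, b j] ∘ Sum.elim 0 1 ∘ σ) ∧
        ¬ L.Sat φ G (![a j, b i] ∘ Sum.elim 0 1 ∘ σ)) ∧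
      ∀ x y z, x < y → y < z → z < t → (a x = b y ↔ c 0) ∧ (a y = b x ↔ c 1) := by
    intro t
    obtain ⟨l, f, hf1, hf2, hf3⟩ := hc t
    refine ⟨G l, hG l, fun i => a l (f i) (), fun i => b l (f i) (), fun i j hij hj => ?_,
      fun x y z hxy hyz hz => ⟨hf3 x y z hxy hyz hz 0, hf3 x y z hxy hyz hz 1⟩⟩
    have key : ∀ x y : Unit → G l,
        ![x (), y ()] ∘ Sum.elim 0 1 ∘ σ = Sum.elim x y ∘ σ := fun x y => by
      funext i
      simp only [Function.comp_apply]
      rcases σ i with x | x <;> rfl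
    rw [key, key]
    exact hab l (f i) (f j) (hf2 i j hij hj) (hf1 j hj)
  clear hc hab
  obtain ⟨h0, h1⟩ : ¬ c 0 ∧ ¬ c 1 := by
    obtain ⟨G, -, a, b, hord, hS⟩ := hom 5
    constructor
    · intro h0
      have h1 : b 1 = b 3 := ((hS 0 1 4 (by omega) (by omega) (by omega)).1.2 h0).symm.trans
        ((hS 0 3 4 (by omega) (by omega) (by omega)).1.2 h0)
      have h2 := (hord 1 2 (by omega) (by omega)).2
      rw [h1] at h2
      exact h2 (hord 2 3 (by omega) (by omega)).1
    · intro h0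
      have h1 : a 1 = a 3 := ((hS 0 1 4 (by omega) (by omega) (by omega)).2.2 h0).trans
        ((hS 0 3 4 (by omega) (by omega) (by omega)).2.2 h0).symm
      have h2 := (hord 1 2 (by omega) (by omega)).1
      rw [h1] at h2
      exact (hord 2 3 (by omega) (by omega)).2 h2
  refine ⟨k, p, φ, Sum.elim 0 1 ∘ σ, fun t => ?_⟩
  obtain ⟨G, hG, a, b, hord, hS⟩ := hom (2 * t + 2)
  -- Even positions for the first part and odd ones for the second turn `i ≤ j` into `2i < 2j + 1`.
  have hle : ∀ i j : Fin t,
      L.Sat φ G (![a (2 * i), b (2 * j + 1)] ∘ Sum.elim 0 1 ∘ σ) ↔ i ≤ j := by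
    intro i j
    rcases le_or_gt i j with hij | hij
    · exact iff_of_true (hord _ _ (by omega) (by omega)).1 hij
    · exact iff_of_false (hord _ _ (by omega) (by omega)).2 hij.not_ge
  have hne : ∀ i j : Fin t, a (2 * i) ≠ b (2 * j + 1) := by
    intro i j heq
    rcases le_or_gt i j with hij | hij
    · exact h0 ((hS (2 * i) (2 * j + 1) (2 * t + 1) (by omega) (by omega) (by omega)).1.1 heq)
    · exact h1 ((hS (2 * j + 1) (2 * i) (2 * t + 1) (by omega) (by omega) (by omega)).2.1 heq)
  refine ⟨G, hG, Sum.elim (fun i => a (2 * i)) (fun j => b (2 * j + 1)),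
    Function.Injective.sumElim (fun i j hij => ?_) (fun i j hij => ?_) hne, hle⟩
  · have hij : a (2 * i) = a (2 * j) := hij
    have h2 := hle i i
    have h3 := hle j j
    rw [hij, hle] at h2
    rw [← hij, hle] at h3
    exact le_antisymm (h3.2 le_rfl) (h2.2 le_rfl)
  · have hij : b (2 * i + 1) = b (2 * j + 1) := hij
    have h2 := hle i i
    have h3 := hle j j
    rw [hij, hle] at h2
    rw [← hij, hle] at h3
    exact le_antisymm (h2.2 le_rfl) (h3.2 le_rfl)

/-- Two colors mark the sides of the half-graph, and the adjacency is the order symmetrized. -/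
theorem HasBipartiteOrder.transduces (hL : L.ExtendsFO) (h : L.HasBipartiteOrder C Unit Unit) :
    L.Transduces C halfGraphs.{v} := by
  obtain ⟨k, p, φ, σ, h⟩ := h.exists_disjoint
  let edge (x y : Fin 2) : ((colored Λ (k + 2)).sum (oneRelLanguage p)).Formula (Fin 2) :=
    (colorFormula (0 : Fin 2) x ⊓ colorFormula (1 : Fin 2) y) ⊓ oneRelFormula (![x, y] ∘ σ)
  obtain ⟨ψd, hψd⟩ := hL.exists_form φ (q := 2) (n := 1)
    (colorFormula (0 : Fin 2) (0 : Fin 1) ⊔ colorFormula (1 : Fin 2) (0 : Fin 1))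
  obtain ⟨ψe, hψe⟩ := hL.exists_form φ (q := 2) (n := 2) (edge 0 1 ⊔ edge 1 0)
  have hd : ∀ (G : Bundled.{v} (colored Λ k).Structure) (Z : Fin 2 → Set G) (x : G),
      L.Sat ψd (addColors G Z) ![x] ↔ x ∈ Z 0 ∨ x ∈ Z 1 := fun G Z x => by
    refine (hψd G Z ![x]).trans (Formula.realize_sup.trans (or_congr ?_ ?_)) <;>
      exact realize_colorFormula ..
  have he : ∀ (G : Bundled.{v} (colored Λ k).Structure) (Z : Fin 2 → Set G) (x : Fin 2 → G),
      L.Sat ψe (addColors G Z) x ↔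
        ((x 0 ∈ Z 0 ∧ x 1 ∈ Z 1) ∧ L.Sat φ G (![x 0, x 1] ∘ σ)) ∨
        ((x 1 ∈ Z 0 ∧ x 0 ∈ Z 1) ∧ L.Sat φ G (![x 1, x 0] ∘ σ)) := fun G Z x => by
    have key : ∀ i j : Fin 2, x ∘ ![i, j] ∘ σ = ![x i, x j] ∘ σ := fun i j => by
      funext m
      simp only [Function.comp_apply]
      generalize σ m = s
      fin_cases s <;> rfl
    have hedge : ∀ i j : Fin 2,
        Formula.Realize (M := expandByRel (addColors G Z) (L.Sat φ G)) (edge i j) x ↔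
          (x i ∈ Z 0 ∧ x j ∈ Z 1) ∧ L.Sat φ G (![x i, x j] ∘ σ) := fun i j => by
      refine Formula.realize_inf.trans (and_congr
        (Formula.realize_inf.trans (and_congr ?_ ?_)) ?_)
      · exact realize_colorFormula ..
      · exact realize_colorFormula ..
      · rw [← key]
        exact realize_oneRelFormula (G := addColors G Z) ..
    exact (hψe G Z x).trans (Formula.realize_sup.trans (or_congr (hedge 0 1) (hedge 1 0)))
  let T : L.Transduction Λ FirstOrder.Language.graph :=
    { numColors := k + 2
      interp :=
        { dom := ψd
          rel := fun {_} R => match R with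
            | .adj => ψe } }
  refine ⟨T, ?_⟩
  rintro H ⟨t, ⟨e⟩⟩
  obtain ⟨G, hG, V, hV, hadj⟩ := h t
  let Z : Fin 2 → Set G := ![Set.range (V ∘ .inl), Set.range (V ∘ .inr)]
  have hl0 : ∀ i, V (.inl i) ∈ Z 0 := fun i => ⟨i, rfl⟩
  have hr1 : ∀ j, V (.inr j) ∈ Z 1 := fun j => ⟨j, rfl⟩
  have hl1 : ∀ i, V (.inl i) ∉ Z 1 := by
    rintro i ⟨j, hj⟩
    exact Sum.inr_ne_inl (hV hj)
  have hr0 : ∀ j, V (.inr j) ∉ Z 0 := by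
    rintro j ⟨i, hi⟩
    exact Sum.inl_ne_inr (hV hi)
  refine ⟨addColors G Z, addColors_mem_colorings hG Z, ?_⟩
  have hdom : ∀ x, L.Sat ψd (addColors G Z) ![V x] := by
    rintro (i | j)
    · exact (hd G Z _).2 (Or.inl (hl0 i))
    · exact (hd G Z _).2 (Or.inr (hr1 j))
  let F : Fin t ⊕ Fin t → T.interp.apply (addColors G Z) := fun x => ⟨V x, hdom x⟩
  have hF : Function.Bijective F := by
    refine ⟨fun x y hxy => hV (Subtype.ext_iff.1 hxy), ?_⟩
    rintro ⟨x, hx⟩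
    rcases (hd G Z x).1 hx with ⟨i, rfl⟩ | ⟨j, rfl⟩
    · exact ⟨.inl i, rfl⟩
    · exact ⟨.inr j, rfl⟩
  let := (halfGraph t).structure
  let F' : (Fin t ⊕ Fin t) ≃[FirstOrder.Language.graph] T.interp.apply (addColors G Z) :=
    { Equiv.ofBijective F hF with
      map_fun' := fun f => isEmptyElim f
      map_rel' := fun {n} R x => by
        change graphRel n at R
        cases R
        refine (he G Z (fun i => V (x i))).trans ?_
        change _ ↔ (halfGraph t).Adj (x 0) (x 1)
        rcases x 0 with i | i <;> rcases x 1 with j | j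
        · simp [hl0, hl1, halfGraph]
        · simp [hl0, hl1, hr0, hr1, hadj, halfGraph]
        · simp [hl0, hl1, hr0, hr1, hadj, halfGraph]
        · simp [hr0, hr1, halfGraph] }
  exact ⟨e.symm.comp F'.symm⟩

theorem exists_mem_halfGraphs (t : ℕ) : ∃ H ∈ halfGraphs.{v},
    Nonempty (letI := (halfGraph t).structure; (Fin t ⊕ Fin t) ≃[FirstOrder.Language.graph] H) := by
  let := (halfGraph t).structure
  let e : (Fin t ⊕ Fin t) ≃ ULift.{v} (Fin t ⊕ Fin t) := Equiv.ulift.symm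
  let := e.inducedStructure (L := FirstOrder.Language.graph)
  exact ⟨⟨ULift.{v} (Fin t ⊕ Fin t), inferInstance⟩, ⟨t, ⟨e.inducedStructureEquiv.symm⟩⟩,
    ⟨e.inducedStructureEquiv⟩⟩

theorem Transduces.not_isMonadicallyStable (hL : L.ExtendsFO) (h : L.Transduces C halfGraphs.{v}) :
    ¬ L.IsMonadicallyStable C := by
  obtain ⟨T, hT⟩ := h
  intro hst
  -- The order is witnessed on the pairs `(aᵢ, bᵢ)`, by the adjacency of `aᵢ` and `bⱼ`.
  obtain ⟨φ, hφ⟩ := hL _ 2 (T.interp.rel adj) (2 + 2) (oneRelFormula ![0, 3])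
  refine hst T.numColors 2 φ fun l => ?_
  obtain ⟨H, hH, ⟨e⟩⟩ := exists_mem_halfGraphs.{v} l
  obtain ⟨G, hG, ⟨e'⟩⟩ := hT hH
  let := (halfGraph l).structure
  let g : (Fin l ⊕ Fin l) ≃[FirstOrder.Language.graph] T.interp.apply G := e'.symm.comp e
  refine ⟨G, hG, fun i => ![(g (.inl i)).1, (g (.inr i)).1], fun i j => ?_⟩
  refine (hφ G _).trans ((realize_oneRelFormula _ _).trans ?_)
  have key : Fin.append ![(g (.inl i)).1, (g (.inr i)).1] ![(g (.inl j)).1, (g (.inr j)).1] ∘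
      ![0, 3] = fun m => ((g ∘ ![.inl i, .inr j]) m).1 := by
    funext m
    fin_cases m <;> rfl
  rw [key]
  exact g.map_rel adj ![.inl i, .inr j]

theorem transduces_halfGraphs_of_not_isMonadicallyStable (hL : L.ExtendsFO)
    (h : ¬ L.IsMonadicallyStable C) : L.Transduces C halfGraphs.{v} := by
  simp only [IsMonadicallyStable, IsStable, not_forall, not_not] at h
  obtain ⟨k, s, φ, h⟩ := h
  have h' : L.HasBipartiteOrder C (Fin s) (Fin s) := by
    refine ⟨k, s + s, φ, finSumFinEquiv.symm, fun l => ?_⟩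
    -- One more entry provides the default value beyond the end of the finite sequence.
    obtain ⟨G, hG, a, ha⟩ := h (l + 1)
    have key : ∀ x y : Fin s → G, Sum.elim x y ∘ finSumFinEquiv.symm = Fin.append x y := by
      intro x y
      funext i
      obtain ⟨i, rfl⟩ := finSumFinEquiv.surjective i
      rw [Function.comp_apply, Equiv.symm_apply_apply]
      rcases i with i | i
      · rw [finSumFinEquiv_apply_left, Fin.append_left, Sum.elim_inl]
      · rw [finSumFinEquiv_apply_right, Fin.append_right, Sum.elim_inr]
    refine ⟨G, hG, fun i => a (Fin.ofNat (l + 1) i), fun i => a (Fin.ofNat (l + 1) i),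
      fun i j hij hj => ?_⟩
    rw [key, key, ha, ha, not_le]
    have hlt : Fin.ofNat (l + 1) i < Fin.ofNat (l + 1) j := by
      rw [Fin.lt_def, Fin.val_ofNat, Fin.val_ofNat, Nat.mod_eq_of_lt (by omega),
        Nat.mod_eq_of_lt (by omega)]
      exact hij
    exact ⟨hlt.le, hlt⟩
  exact (h'.to_unit hL).transduces hL

end AbstractLogic

theorem mainTheorem12 :
    (FO.{u, v}.ExtendsFO ∧ MSO.{u, v}.ExtendsFO ∧ CMSO.{u, v}.ExtendsFO) ∧
    ∀ (L : AbstractLogic.{u, v, w}), L.ExtendsFO →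
      ∀ (Λ : FirstOrder.Language.{0, u}) [Λ.IsRelational] (C : Set (Bundled.{v} Λ.Structure)),
        L.IsMonadicallyStable C ↔ ¬ L.Transduces C halfGraphs.{v} := by
  refine ⟨⟨FO_extendsFO, monadicLogic_extendsFO False, monadicLogic_extendsFO True⟩,
    fun L hL Λ _ C => ⟨fun hst h => h.not_isMonadicallyStable hL hst, fun h => ?_⟩⟩
  by_contra hst
  exact h (AbstractLogic.transduces_halfGraphs_of_not_isMonadicallyStable hL hst)
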